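/- Let $H$ be a finite $d$-uniform hypergraph with $d\ge 1$, with vertex set $V=\{x_1,\dots,x_n\}$ and edge set $E(H)$ (a set of $d$-element subsets of $V$), and let $K$ be a field. For $e\in E(H)$ put $x^e:=\prod_{v\in e}v\in K[x_1,\dots,x_n]$, let $K[H]:=K[x^e: e\in E(H)]$ be the edge subring, and let the toric ideal $I_H$ be the kernel of the $K$-algebra homomorphism $K[t_e: e\in E(H)]\to K[H]$, $t_e\mapsto x^e$. A monomial walk on $H$ is a sequence $W=(e_1,\dots,e_{2r})$, $r\ge 1$, of edges of $H$ (repetitions allowed) such that each $e_i$ with $i\ge 2$ intersects some $e_j$ with $j<i$, and each vertex $v\in\bigcup_i e_i$ satisfies $$|\{i : v\in e_i,\ i\text{ odd}\}| = |\{i : v\in e_i,\ i\text{ even}\}|.$$ Its binomial is $f_W:=\prod_{i=1}^{r}t_{e_{2i-1}}-\prod_{i=1}^{r}t_{e_{2i}}$. The walk $W$ is primitive if it has no proper subwalk, that is, if there is no monomial walk $W'$ whose multiset of odd-numbered edges is contained in that of $W$ and whose multiset of even-numbered edges is contained in that of $W$, at least one of the two inclusions being proper. Then, for every monomial order on $K[t_e: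 e\in E(H)]$, every polynomial $f$ in the reduced Gröbner basis of $I_H$ has the form $f=f_W$ for some primitive monomial walk $W$ on $H$. (A reduced Gröbner basis has elements with leading coefficient $1$, and no monomial of one element is divisible by the leading monomial of another.) -/

import Mathlib

namespace Hypergraph

/-- A hypergraph is `d`-uniform if each of its edges consists of exactly `d` vertices. -/
def IsUniform {α : Type*} (H : Hypergraph α) (d : ℕ) : Prop :=
  ∀ e ∈ H.edgeSet, e.Finite ∧ e.ncard = d

/-- The squarefree monomial `x ^ e = ∏ v ∈ e, x_v` in the polynomial ring over `k` whose variables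
are the vertices of `H`. -/
noncomputable def edgeMonomial {α : Type*} (H : Hypergraph α) (k : Type*) [Field k]
    (e : H.edgeSet) : MvPolynomial H.vertexSet k :=
  ∏ᶠ v ∈ {v : H.vertexSet | (v : α) ∈ (e : Set α)}, MvPolynomial.X v

/-- The edge subring `k[H] = k[x ^ e : e ∈ E(H)]`. -/
noncomputable def edgeSubring {α : Type*} (H : Hypergraph α) (k : Type*) [Field k] :
    Subalgebra k (MvPolynomial H.vertexSet k) :=
  Algebra.adjoin k (Set.range (H.edgeMonomial k))

/-- The homomorphism `k[t_e : e ∈ E(H)] → k[H]`, `t_e ↦ x ^ e`. -/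
noncomputable def edgeHom {α : Type*} (H : Hypergraph α) (k : Type*) [Field k] :
    MvPolynomial H.edgeSet k →ₐ[k] H.edgeSubring k :=
  MvPolynomial.aeval fun e : H.edgeSet =>
    (⟨H.edgeMonomial k e, Algebra.subset_adjoin (Set.mem_range_self e)⟩ : H.edgeSubring k)

/-- The toric ideal `I_H` of the edge subring of `H`. -/
noncomputable def toricIdeal {α : Type*} (H : Hypergraph α) (k : Type*) [Field k] :
    Ideal (MvPolynomial H.edgeSet k) :=
  RingHom.ker (H.edgeHom k)

/-- A monomial walk `e_1, e_2, …, e_{2n}` on `H` (nonempty, so `n ≥ 1`). The edge `e_i` is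
`W ⟨i - 1, _⟩`: the odd-numbered edges `e_1, e_3, …` are those at the even positions
`0, 2, …` of `W`, and the even-numbered edges `e_2, e_4, …` are those at its odd positions. -/
structure IsMonomialWalk {α : Type*} (H : Hypergraph α) {n : ℕ} (W : Fin (2 * n) → H.edgeSet) :
    Prop where
  pos : 0 < n
  /-- Each edge after the first one intersects one of the preceding edges. -/
  inter : ∀ i : Fin (2 * n), 0 < (i : ℕ) →
    ∃ j : Fin (2 * n), j < i ∧ ((W i : Set α) ∩ (W j : Set α)).Nonempty
  /-- Each covered vertex lies on equally many odd- and even-numbered edges, counted with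
  multiplicity. -/
  balanced : ∀ v ∈ ⋃ i, (W i : Set α),
    {i : Fin (2 * n) | Even (i : ℕ) ∧ v ∈ (W i : Set α)}.ncard =
      {i : Fin (2 * n) | Odd (i : ℕ) ∧ v ∈ (W i : Set α)}.ncard

/-- The multiset of odd-numbered edges `e_1, e_3, …, e_{2n-1}`. -/
def oddEdges {α : Type*} (H : Hypergraph α) {n : ℕ} (W : Fin (2 * n) → H.edgeSet) :
    Multiset H.edgeSet :=
  Finset.univ.val.map fun i : Fin n => W ⟨2 * (i : ℕ), by omega⟩

/-- The multiset of even-numbered edges `e_2, e_4, …, e_{2n}`. -/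
def evenEdges {α : Type*} (H : Hypergraph α) {n : ℕ} (W : Fin (2 * n) → H.edgeSet) :
    Multiset H.edgeSet :=
  Finset.univ.val.map fun i : Fin n => W ⟨2 * (i : ℕ) + 1, by omega⟩

/-- The binomial `f_W = ∏ t_{e_{2i-1}} - ∏ t_{e_{2i}}` arising from `W`. -/
noncomputable def walkBinomial {α : Type*} (H : Hypergraph α) (k : Type*) [Field k] {n : ℕ}
    (W : Fin (2 * n) → H.edgeSet) : MvPolynomial H.edgeSet k :=
  (∏ i : Fin n, MvPolynomial.X (W ⟨2 * (i : ℕ), by omega⟩)) -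
    ∏ i : Fin n, MvPolynomial.X (W ⟨2 * (i : ℕ) + 1, by omega⟩)

/-- `W'` is a proper subwalk of `W`: it is a monomial walk, its odd-numbered edges are among those
of `W` and its even-numbered edges are among those of `W` (as multisets, in any order), and at
least one of these two inclusions is proper. -/
def IsProperSubwalk {α : Type*} (H : Hypergraph α) {l n : ℕ}
    (W' : Fin (2 * l) → H.edgeSet) (W : Fin (2 * n) → H.edgeSet) : Prop :=
  H.IsMonomialWalk W' ∧ H.oddEdges W' ≤ H.oddEdges W ∧ H.evenEdges W' ≤ H.evenEdges W ∧
    (H.oddEdges W' < H.oddEdges W ∨ H.evenEdges W' < H.evenEdges W)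

/-- A primitive monomial walk: a monomial walk without proper subwalks. -/
def IsPrimitiveMonomialWalk {α : Type*} (H : Hypergraph α) {n : ℕ}
    (W : Fin (2 * n) → H.edgeSet) : Prop :=
  H.IsMonomialWalk W ∧ ¬ ∃ (l : ℕ) (W' : Fin (2 * l) → H.edgeSet), H.IsProperSubwalk W' W

end Hypergraph

namespace MonomialOrder

/-- `G` is a Gröbner basis of the ideal `I` with respect to the monomial order `m`: a finite subset
of `I` whose leading terms generate the ideal of all leading terms of elements of `I`. -/
structure IsGroebnerBasis {σ : Type*} (m : MonomialOrder σ) {k : Type*} [Field k]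
    (I : Ideal (MvPolynomial σ k)) (G : Set (MvPolynomial σ k)) : Prop where
  finite : G.Finite
  subset : G ⊆ I
  span_leadingTerm : Ideal.span (m.leadingTerm '' G) =
    Ideal.span (m.leadingTerm '' (I : Set (MvPolynomial σ k)))

/-- A reduced Gröbner basis: its elements are monic, and no monomial occurring in one element is
divisible by the leading monomial of another one. -/
structure IsReducedGroebnerBasis {σ : Type*} (m : MonomialOrder σ) {k : Type*} [Field k]
    (I : Ideal (MvPolynomial σ k)) (G : Set (MvPolynomial σ k)) : Prop
    extends m.IsGroebnerBasis I G where
  monic : ∀ g ∈ G, m.Monic g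
  reduced : ∀ g ∈ G, ∀ g' ∈ G, g' ≠ g → ∀ c ∈ g.support, ¬ m.degree g' ≤ c

end MonomialOrder

/-! The map `t_e ↦ x ^ e` sends monomials to monomials, the exponents of the image being vertex
degrees. Hence the leading monomial `t ^ u` of `f` can only cancel against another monomial `t ^ w`
of `f` with the same vertex degrees (`exists_mem_support_vertexDegree_eq`). Then `t ^ u - t ^ w`
lies in `I_H`, and reducedness forces `f` to equal it (`eq_binomial`). Reducedness also rules out
smaller balanced pairs inside `(u, w)` (`isPrimitivePair_of_mem_reducedGroebnerBasis`).

It remains to order the edges of such a primitive pair into a walk (`exists_connectedSeq`). Since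
`f_W` depends only on the two multisets, any alternating order will do if it is connected. Edges are
added greedily: an incomplete enumeration is unbalanced by primitivity, so by the handshake lemma
some vertex is covered too rarely on the side that is next, and an unused edge through it meets an
earlier edge. -/

namespace Hypergraph

/-! ### Vertex degrees of multisets of edges -/

variable {α : Type*} (H : Hypergraph α)

open Classical in
/-- The number of members of the multiset `M` of edges that contain the vertex `v`. -/
noncomputable def vertexDegree (M : Multiset H.edgeSet) (v : α) : ℕ :=
  M.countP fun e : H.edgeSet => v ∈ (e : Set α)

@[simp]
lemma vertexDegree_zero (v : α) : H.vertexDegree 0 v = 0 := by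
  simp [vertexDegree]

@[simp]
lemma vertexDegree_add (M N : Multiset H.edgeSet) (v : α) :
    H.vertexDegree (M + N) v = H.vertexDegree M v + H.vertexDegree N v := by
  simp [vertexDegree]

lemma vertexDegree_mono {M N : Multiset H.edgeSet} (h : M ≤ N) (v : α) :
    H.vertexDegree M v ≤ H.vertexDegree N v := by
  classical exact Multiset.countP_le_of_le _ h

open Classical in
lemma vertexDegree_cons (e : H.edgeSet) (M : Multiset H.edgeSet) (v : α) :
    H.vertexDegree (e ::ₘ M) v = H.vertexDegree M v + if v ∈ (e : Set α) then 1 else 0 := by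
  simp [vertexDegree, Multiset.countP_cons]

lemma exists_mem_of_vertexDegree_pos {M : Multiset H.edgeSet} {v : α}
    (h : 0 < H.vertexDegree M v) : ∃ e ∈ M, v ∈ (e : Set α) := by
  simpa [vertexDegree, Multiset.countP_pos] using h

lemma vertexDegree_eq_zero {M : Multiset H.edgeSet} {v : α} (h : v ∉ H.vertexSet) :
    H.vertexDegree M v = 0 := by
  by_contra h0
  obtain ⟨e, -, hv⟩ := H.exists_mem_of_vertexDegree_pos (Nat.pos_of_ne_zero h0)
  exact h (H.mem_vertexSet_of_mem_edgeSet e.2 hv)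

variable {H}

/-- Handshake lemma: in a `d`-uniform hypergraph the vertex degrees add up to `d` times the number
of edges. -/
lemma IsUniform.sum_vertexDegree {d : ℕ} (hH : H.IsUniform d) (hV : H.vertexSet.Finite)
    (M : Multiset H.edgeSet) :
    ∑ v ∈ hV.toFinset, H.vertexDegree M v = d * M.card := by
  classical
  induction M using Multiset.induction_on with
  | empty => simp
  | cons e M ih =>
    obtain ⟨hfin, hcard⟩ := hH e e.2
    have : hV.toFinset.filter (fun v => v ∈ (e : Set α)) = hfin.toFinset := by
      ext v
      simpa using fun hv => H.mem_vertexSet_of_mem_edgeSet e.2 hv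
    simp only [vertexDegree_cons, Finset.sum_add_distrib, ih, Finset.sum_boole, this,
      Multiset.card_cons, ← hcard, Set.ncard_eq_toFinset_card _ hfin]
    simp [mul_add]

lemma IsUniform.card_eq_of_vertexDegree_eq {d : ℕ} (hH : H.IsUniform d)
    (hV : H.vertexSet.Finite) (hd : 1 ≤ d) {M N : Multiset H.edgeSet}
    (h : ∀ v, H.vertexDegree M v = H.vertexDegree N v) : M.card = N.card := by
  have := hH.sum_vertexDegree hV M
  simp only [h, hH.sum_vertexDegree hV N] at this
  exact (Nat.eq_of_mul_eq_mul_left hd this).symm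

lemma IsUniform.exists_vertexDegree_lt_of_card_lt {d : ℕ} (hH : H.IsUniform d)
    (hV : H.vertexSet.Finite) (hd : 1 ≤ d) {M N : Multiset H.edgeSet}
    (h : M.card < N.card) : ∃ v, H.vertexDegree M v < H.vertexDegree N v := by
  by_contra! hc
  have := Finset.sum_le_sum fun v (_ : v ∈ hV.toFinset) => hc v
  rw [hH.sum_vertexDegree hV, hH.sum_vertexDegree hV] at this
  have := Nat.le_of_mul_le_mul_left this hd
  omega

/-- By the handshake lemma both degree sums agree, so a one-sided inequality at every vertex would
be an equality at every vertex. -/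
lemma IsUniform.exists_vertexDegree_lt_of_card_eq {d : ℕ} (hH : H.IsUniform d)
    (hV : H.vertexSet.Finite) {M N : Multiset H.edgeSet} (h : M.card = N.card)
    (hne : ∃ v, H.vertexDegree M v ≠ H.vertexDegree N v) :
    ∃ v, H.vertexDegree M v < H.vertexDegree N v := by
  by_contra! hc
  have hs : ∑ v ∈ hV.toFinset, H.vertexDegree N v = ∑ v ∈ hV.toFinset, H.vertexDegree M v := by
    rw [hH.sum_vertexDegree hV, hH.sum_vertexDegree hV, h]
  obtain ⟨v, hv⟩ := hne
  by_cases hvV : v ∈ H.vertexSet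
  · exact hv ((Finset.sum_eq_sum_iff_of_le fun v _ => hc v).1 hs v (by simpa)).symm
  · exact hv (by rw [vertexDegree_eq_zero H hvV, vertexDegree_eq_zero H hvV])

/-! ### Primitive pairs and their enumeration as walks -/

/-- A pair of multisets of edges with equal vertex degrees all of whose balanced subpairs are
trivial. -/
structure IsPrimitivePair (H : Hypergraph α) (U V : Multiset H.edgeSet) : Prop where
  ne_zero : U ≠ 0
  balanced : ∀ v, H.vertexDegree U v = H.vertexDegree V v
  minimal : ∀ P ≤ U, ∀ Q ≤ V, (∀ v, H.vertexDegree P v = H.vertexDegree Q v) →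
    P = 0 ∨ P = U ∧ Q = V

lemma exists_cons_le_of_vertexDegree_lt {P U : Multiset H.edgeSet} {v : α} (h : P ≤ U)
    (hv : H.vertexDegree P v < H.vertexDegree U v) :
    ∃ e : H.edgeSet, v ∈ (e : Set α) ∧ e ::ₘ P ≤ U := by
  obtain ⟨R, rfl⟩ := Multiset.le_iff_exists_add.1 h
  rw [vertexDegree_add] at hv
  obtain ⟨e, he, hve⟩ := H.exists_mem_of_vertexDegree_pos (M := R) (v := v) (by omega)
  refine ⟨e, hve, ?_⟩
  rw [← Multiset.singleton_add, add_comm]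
  exact Multiset.le_iff_exists_add.2 (by
    obtain ⟨R', rfl⟩ := Multiset.exists_cons_of_mem he
    exact ⟨R', by rw [← Multiset.singleton_add]; abel⟩)

/-- The edges at the even positions below `i` of a sequence. -/
def evenPart (H : Hypergraph α) (W : ℕ → H.edgeSet) (i : ℕ) : Multiset H.edgeSet :=
  ((Multiset.range i).filter Even).map W

/-- The edges at the odd positions below `i` of a sequence. -/
def oddPart (H : Hypergraph α) (W : ℕ → H.edgeSet) (i : ℕ) : Multiset H.edgeSet :=
  ((Multiset.range i).filter Odd).map W

lemma evenPart_two_mul_add_one (W : ℕ → H.edgeSet) (j : ℕ) :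
    H.evenPart W (2 * j + 1) = W (2 * j) ::ₘ H.evenPart W (2 * j) := by
  simp [evenPart, Multiset.range_succ]

lemma oddPart_two_mul_add_one (W : ℕ → H.edgeSet) (j : ℕ) :
    H.oddPart W (2 * j + 1) = H.oddPart W (2 * j) := by
  simp [oddPart, Multiset.range_succ]

lemma evenPart_two_mul_add_two (W : ℕ → H.edgeSet) (j : ℕ) :
    H.evenPart W (2 * j + 2) = H.evenPart W (2 * j + 1) := by
  have : ¬ Even (2 * j + 1) := by simp
  rw [evenPart, Multiset.range_succ, Multiset.filter_cons_of_neg _ this, evenPart]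

lemma oddPart_two_mul_add_two (W : ℕ → H.edgeSet) (j : ℕ) :
    H.oddPart W (2 * j + 2) = W (2 * j + 1) ::ₘ H.oddPart W (2 * j + 1) := by
  have : Odd (2 * j + 1) := by simp
  rw [oddPart, Multiset.range_succ, Multiset.filter_cons_of_pos _ this, Multiset.map_cons, oddPart]

lemma evenPart_congr {W W' : ℕ → H.edgeSet} {i : ℕ} (h : ∀ j < i, W j = W' j) :
    H.evenPart W i = H.evenPart W' i :=
  Multiset.map_congr rfl fun j hj => h j (by simp at hj; exact hj.1)

lemma oddPart_congr {W W' : ℕ → H.edgeSet} {i : ℕ} (h : ∀ j < i, W j = W' j) :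
    H.oddPart W i = H.oddPart W' i :=
  Multiset.map_congr rfl fun j hj => h j (by simp at hj; exact hj.1)

lemma evenPart_two_mul (W : ℕ → H.edgeSet) (n : ℕ) :
    H.evenPart W (2 * n) = (Multiset.range n).map fun i => W (2 * i) := by
  induction n with
  | zero => simp [evenPart]
  | succ n ih =>
    rw [mul_add, mul_one, evenPart_two_mul_add_two, evenPart_two_mul_add_one, ih]
    simp [Multiset.range_succ]

lemma oddPart_two_mul (W : ℕ → H.edgeSet) (n : ℕ) :
    H.oddPart W (2 * n) = (Multiset.range n).map fun i => W (2 * i + 1) := by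
  induction n with
  | zero => simp [oddPart]
  | succ n ih =>
    rw [mul_add, mul_one, oddPart_two_mul_add_two, oddPart_two_mul_add_one, ih]
    simp [Multiset.range_succ]

/-- Positions count from 0 but edges from 1, so odd-numbered edges sit at even positions. -/
lemma oddEdges_restrict (W : ℕ → H.edgeSet) (n : ℕ) :
    H.oddEdges (n := n) (fun i => W i) = H.evenPart W (2 * n) := by
  rw [evenPart_two_mul]
  simp only [oddEdges]
  rw [← Finset.range_val, ← Nat.Iio_eq_range, ← Fin.map_valEmbedding_univ, Finset.map_val, Multiset.map_map]
  rfl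

lemma evenEdges_restrict (W : ℕ → H.edgeSet) (n : ℕ) :
    H.evenEdges (n := n) (fun i => W i) = H.oddPart W (2 * n) := by
  rw [oddPart_two_mul]
  simp only [evenEdges]
  rw [← Finset.range_val, ← Nat.Iio_eq_range, ← Fin.map_valEmbedding_univ, Finset.map_val, Multiset.map_map]
  rfl

lemma vertexDegree_oddEdges {n : ℕ} (W : Fin (2 * n) → H.edgeSet) (v : α) :
    H.vertexDegree (H.oddEdges W) v =
      {i : Fin (2 * n) | Even (i : ℕ) ∧ v ∈ (W i : Set α)}.ncard := by
  classical
  rw [vertexDegree, oddEdges, Multiset.countP_map, ← Finset.filter_val, ← Finset.card_def,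
    ← Set.ncard_coe_finset]
  refine Set.ncard_congr (fun i _ => ⟨2 * (i : ℕ), by omega⟩) ?_ ?_ ?_
  · intro i hi
    simpa using hi
  · intro i j _ _ h
    simpa [Fin.ext_iff] using h
  · rintro ⟨i, hi⟩ ⟨⟨j, hj⟩, hv⟩
    obtain rfl : i = 2 * j := by simp at hj; omega
    exact ⟨⟨j, by omega⟩, by simpa using hv, rfl⟩

lemma vertexDegree_evenEdges {n : ℕ} (W : Fin (2 * n) → H.edgeSet) (v : α) :
    H.vertexDegree (H.evenEdges W) v =
      {i : Fin (2 * n) | Odd (i : ℕ) ∧ v ∈ (W i : Set α)}.ncard := by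
  classical
  rw [vertexDegree, evenEdges, Multiset.countP_map, ← Finset.filter_val, ← Finset.card_def,
    ← Set.ncard_coe_finset]
  refine Set.ncard_congr (fun i _ => ⟨2 * (i : ℕ) + 1, by omega⟩) ?_ ?_ ?_
  · intro i hi
    simpa using hi
  · intro i j _ _ h
    simpa [Fin.ext_iff] using h
  · rintro ⟨i, hi⟩ ⟨⟨j, hj⟩, hv⟩
    obtain rfl : i = 2 * j + 1 := by simpa using hj
    exact ⟨⟨j, by omega⟩, by simpa using hv, rfl⟩

lemma IsMonomialWalk.vertexDegree_eq {n : ℕ} {W : Fin (2 * n) → H.edgeSet}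
    (hW : H.IsMonomialWalk W) (v : α) :
    H.vertexDegree (H.oddEdges W) v = H.vertexDegree (H.evenEdges W) v := by
  rw [vertexDegree_oddEdges, vertexDegree_evenEdges]
  by_cases hv : v ∈ ⋃ i, (W i : Set α)
  · exact hW.balanced v hv
  · simp only [Set.mem_iUnion, not_exists] at hv
    simp [hv]

lemma card_oddEdges {n : ℕ} (W : Fin (2 * n) → H.edgeSet) : (H.oddEdges W).card = n := by
  simp [oddEdges]

lemma card_evenPart (W : ℕ → H.edgeSet) (n : ℕ) : (H.evenPart W (2 * n)).card = n := by
  simp [evenPart_two_mul]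

lemma card_oddPart (W : ℕ → H.edgeSet) (n : ℕ) : (H.oddPart W (2 * n)).card = n := by
  simp [oddPart_two_mul]

lemma exists_mem_of_vertexDegree_evenPart {W : ℕ → H.edgeSet} {i : ℕ} {v : α}
    (h : 0 < H.vertexDegree (H.evenPart W i) v) : ∃ j < i, v ∈ (W j : Set α) := by
  obtain ⟨e, he, hv⟩ := H.exists_mem_of_vertexDegree_pos h
  simp only [evenPart, Multiset.mem_map, Multiset.mem_filter, Multiset.mem_range] at he
  obtain ⟨j, hj, rfl⟩ := he
  exact ⟨j, hj.1, hv⟩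

lemma exists_mem_of_vertexDegree_oddPart {W : ℕ → H.edgeSet} {i : ℕ} {v : α}
    (h : 0 < H.vertexDegree (H.oddPart W i) v) : ∃ j < i, v ∈ (W j : Set α) := by
  obtain ⟨e, he, hv⟩ := H.exists_mem_of_vertexDegree_pos h
  simp only [oddPart, Multiset.mem_map, Multiset.mem_filter, Multiset.mem_range] at he
  obtain ⟨j, hj, rfl⟩ := he
  exact ⟨j, hj.1, hv⟩

/-- `W` restricted to the positions below `i` is a connected sequence. -/
def IsConnectedSeq (H : Hypergraph α) (W : ℕ → H.edgeSet) (i : ℕ) : Prop :=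
  ∀ a < i, 0 < a → ∃ b < a, ((W a : Set α) ∩ (W b : Set α)).Nonempty

lemma IsConnectedSeq.update {W : ℕ → H.edgeSet} {i : ℕ} (hW : H.IsConnectedSeq W i)
    {e : H.edgeSet} (he : 0 < i → ∃ b < i, ((e : Set α) ∩ (W b : Set α)).Nonempty) :
    H.IsConnectedSeq (Function.update W i e) (i + 1) := by
  intro a ha ha0
  rcases Nat.lt_succ_iff_lt_or_eq.1 ha with ha | rfl
  · obtain ⟨b, hb, h⟩ := hW a ha ha0
    refine ⟨b, hb, ?_⟩
    rwa [Function.update_of_ne (by omega), Function.update_of_ne (by omega)]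
  · obtain ⟨b, hb, h⟩ := he ha0
    refine ⟨b, hb, ?_⟩
    rwa [Function.update_self, Function.update_of_ne (by omega)]

/-- The edges of a primitive pair can be enumerated alternately in a connected way: as long as the
enumeration is incomplete, counting degrees yields a vertex at which it can be continued. -/
lemma IsPrimitivePair.exists_connectedSeq {U V : Multiset H.edgeSet} (h : H.IsPrimitivePair U V)
    {d : ℕ} (hH : H.IsUniform d) (hV : H.vertexSet.Finite) (hd : 1 ≤ d) :
    ∀ j ≤ U.card, ∃ W : ℕ → H.edgeSet, H.evenPart W (2 * j) ≤ U ∧ H.oddPart W (2 * j) ≤ V ∧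
      H.IsConnectedSeq W (2 * j) := by
  intro j
  induction j with
  | zero =>
    intro _
    obtain ⟨e, -⟩ := Multiset.exists_mem_of_ne_zero h.ne_zero
    exact ⟨fun _ => e, by simp [evenPart], by simp [oddPart], fun a ha => by omega⟩
  | succ j ih =>
    intro hj
    obtain ⟨W, hP, hQ, hW⟩ := ih (by omega)
    -- The next edge from `U`. For `j > 0` the two parts have equal size `j` with `0 < j < U.card`,
    -- so by minimality they are not balanced, and some vertex is covered more often by the `V`
    -- side. As `U` and `V` have equal degrees, an edge of `U` through that vertex is still unused.
    obtain ⟨e, heU, he⟩ : ∃ e : H.edgeSet, e ::ₘ H.evenPart W (2 * j) ≤ U ∧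
        (0 < 2 * j → ∃ b < 2 * j, ((e : Set α) ∩ (W b : Set α)).Nonempty) := by
      rcases Nat.eq_zero_or_pos j with rfl | hj0
      · obtain ⟨e, he⟩ := Multiset.exists_mem_of_ne_zero h.ne_zero
        exact ⟨e, by simpa [evenPart] using he, by simp⟩
      · obtain ⟨v, hv⟩ := hH.exists_vertexDegree_lt_of_card_eq hV
          (M := H.evenPart W (2 * j)) (N := H.oddPart W (2 * j))
          (by rw [card_evenPart, card_oddPart]) (by
            by_contra! hc
            have hcard := card_evenPart W j
            rcases h.minimal _ hP _ hQ hc with h0 | ⟨h1, -⟩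
            · simp [h0] at hcard
              omega
            · rw [h1] at hcard
              omega)
        obtain ⟨e, hve, heU⟩ := exists_cons_le_of_vertexDegree_lt hP (v := v) (by
          rw [h.balanced]
          exact hv.trans_le (H.vertexDegree_mono hQ v))
        obtain ⟨b, hb, hvb⟩ := exists_mem_of_vertexDegree_oddPart (Nat.zero_lt_of_lt hv)
        exact ⟨e, heU, fun _ => ⟨b, hb, v, hve, hvb⟩⟩
    set W₁ := Function.update W (2 * j) e with hW₁
    have hc₁ : H.IsConnectedSeq W₁ (2 * j + 1) := hW.update he
    have hag : ∀ i < 2 * j, W₁ i = W i := fun i hi => Function.update_of_ne (by omega) _ _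
    have hP₁ : H.evenPart W₁ (2 * j + 1) ≤ U := by
      rw [evenPart_two_mul_add_one, evenPart_congr hag, hW₁, Function.update_self]
      exact heU
    have hQ₁ : H.oddPart W₁ (2 * j + 1) ≤ V := by
      rw [oddPart_two_mul_add_one, oddPart_congr hag]
      exact hQ
    -- The `U` side is now one edge ahead, so a deficient vertex on the `V` side exists without
    -- appeal to minimality.
    obtain ⟨v, hv⟩ := hH.exists_vertexDegree_lt_of_card_lt hV hd
      (M := H.oddPart W₁ (2 * j + 1)) (N := H.evenPart W₁ (2 * j + 1)) (by
        rw [oddPart_two_mul_add_one, evenPart_two_mul_add_one, Multiset.card_cons, card_evenPart,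
          card_oddPart]
        omega)
    obtain ⟨e', hve, heV⟩ := exists_cons_le_of_vertexDegree_lt hQ₁ (v := v) (by
      rw [← h.balanced]
      exact hv.trans_le (H.vertexDegree_mono hP₁ v))
    obtain ⟨b, hb, hvb⟩ := exists_mem_of_vertexDegree_evenPart (Nat.zero_lt_of_lt hv)
    have hag' : ∀ i < 2 * j + 1, Function.update W₁ (2 * j + 1) e' i = W₁ i :=
      fun i hi => Function.update_of_ne (by omega) _ _
    refine ⟨Function.update W₁ (2 * j + 1) e', ?_, ?_, hc₁.update fun _ => ⟨b, hb, v, hve, hvb⟩⟩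
    · rw [mul_add, mul_one, evenPart_two_mul_add_two, evenPart_congr hag']
      exact hP₁
    · rw [mul_add, mul_one, oddPart_two_mul_add_two, oddPart_congr hag', Function.update_self]
      exact heV

/-- At full length the inclusions become equalities by cardinality. A proper subwalk would be a
balanced subpair that is neither empty nor everything. -/
lemma IsPrimitivePair.exists_isPrimitiveMonomialWalk {U V : Multiset H.edgeSet}
    (h : H.IsPrimitivePair U V) {d : ℕ} (hH : H.IsUniform d) (hV : H.vertexSet.Finite)
    (hd : 1 ≤ d) : ∃ (n : ℕ) (W : Fin (2 * n) → H.edgeSet), H.IsPrimitiveMonomialWalk W ∧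
      H.oddEdges W = U ∧ H.evenEdges W = V := by
  obtain ⟨W, hP, hQ, hW⟩ := h.exists_connectedSeq hH hV hd U.card le_rfl
  have hodd : H.oddEdges (n := U.card) (fun i => W i) = U := by
    rw [oddEdges_restrict]
    exact Multiset.eq_of_le_of_card_le hP (by rw [card_evenPart])
  have heven : H.evenEdges (n := U.card) (fun i => W i) = V := by
    rw [evenEdges_restrict]
    exact Multiset.eq_of_le_of_card_le hQ
      (by rw [card_oddPart, hH.card_eq_of_vertexDegree_eq hV hd h.balanced])
  refine ⟨U.card, fun i => W i, ⟨⟨Multiset.card_pos.2 h.ne_zero, ?_, ?_⟩, ?_⟩, hodd, heven⟩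
  · intro i hi
    obtain ⟨b, hb, hne⟩ := hW i i.2 hi
    exact ⟨⟨b, by omega⟩, hb, hne⟩
  · intro v _
    rw [← vertexDegree_oddEdges (fun i => W i), ← vertexDegree_evenEdges (fun i => W i), hodd,
      heven, h.balanced]
  · rintro ⟨l, W', hW', hle, hle', hlt⟩
    rw [hodd] at hle hlt
    rw [heven] at hle' hlt
    rcases h.minimal _ hle _ hle' hW'.vertexDegree_eq with h0 | ⟨h1, h2⟩
    · have := card_oddEdges W'
      rw [h0] at this
      exact hW'.pos.ne this
    · rcases hlt with hlt | hlt
      · exact hlt.ne h1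
      · exact hlt.ne h2

end Hypergraph

/-! ### Reduced Gröbner bases -/

namespace MonomialOrder

variable {σ : Type*} {m : MonomialOrder σ} {k : Type*} [Field k] {I : Ideal (MvPolynomial σ k)}
  {G : Set (MvPolynomial σ k)}

lemma IsReducedGroebnerBasis.exists_degree_le (hG : m.IsReducedGroebnerBasis I G)
    {h : MvPolynomial σ k} (hI : h ∈ I) (h0 : h ≠ 0) : ∃ g ∈ G, m.degree g ≤ m.degree h := by
  classical
  have himage : m.leadingTerm '' G =
      (fun s => MvPolynomial.monomial s (1 : k)) '' (m.degree '' G) := by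
    rw [Set.image_image]
    refine Set.image_congr fun g hg => ?_
    rw [leadingTerm, (hG.monic g hg).leadingCoeff_eq_one]
  have hmem : m.leadingTerm h ∈ Ideal.span (m.leadingTerm '' G) := by
    rw [hG.span_leadingTerm]
    exact Ideal.subset_span ⟨h, hI, rfl⟩
  rw [himage, MvPolynomial.mem_ideal_span_monomial_image] at hmem
  obtain ⟨-, ⟨g, hg, rfl⟩, hle⟩ := hmem (m.degree h) (by
    rw [m.support_leadingTerm' h0]
    exact Finset.mem_singleton_self _)
  exact ⟨g, hg, hle⟩

/-- Some element of `G` has leading monomial dividing that of `h`, hence dividing `c`; reducedness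
leaves only `f` itself. Here `c` may be a non-leading monomial of `f`. -/
lemma IsReducedGroebnerBasis.degree_le_of_le_mem_support (hG : m.IsReducedGroebnerBasis I G)
    {f h : MvPolynomial σ k} (hf : f ∈ G) (hI : h ∈ I) (h0 : h ≠ 0) {c : σ →₀ ℕ}
    (hc : c ∈ f.support) (hle : m.degree h ≤ c) : m.degree f ≤ m.degree h := by
  obtain ⟨g, hg, hgh⟩ := hG.exists_degree_le hI h0
  by_cases hgf : g = f
  · rwa [← hgf]
  · exact absurd (hgh.trans hle) (hG.reduced f hf g hg hgf c hc)

lemma degree_monomial_sub_monomial {a b : σ →₀ ℕ} (hab : a ≠ b) :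
    m.degree (MvPolynomial.monomial a (1 : k) - MvPolynomial.monomial b 1) = a ∨
      m.degree (MvPolynomial.monomial a (1 : k) - MvPolynomial.monomial b 1) = b := by
  classical
  have h0 : MvPolynomial.monomial a (1 : k) - MvPolynomial.monomial b 1 ≠ 0 := by
    rw [sub_ne_zero, Ne, MvPolynomial.monomial_eq_monomial_iff]
    simp [hab]
  have := MvPolynomial.support_sub _ _ _ (m.degree_mem_support h0)
  simpa [MvPolynomial.support_monomial] using this

/-- An element of a reduced Gröbner basis is equal to any binomial of the ideal with the same
leading monomial and whose other monomial occurs in it. -/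
lemma IsReducedGroebnerBasis.eq_binomial (hG : m.IsReducedGroebnerBasis I G)
    {f : MvPolynomial σ k} (hf : f ∈ G) {w : σ →₀ ℕ} (hw : w ∈ f.support)
    (hwf : w ≠ m.degree f)
    (hI : MvPolynomial.monomial (m.degree f) (1 : k) - MvPolynomial.monomial w 1 ∈ I) :
    f = MvPolynomial.monomial (m.degree f) (1 : k) - MvPolynomial.monomial w 1 := by
  classical
  set b := MvPolynomial.monomial (m.degree f) (1 : k) - MvPolynomial.monomial w 1 with hb
  by_contra hne
  -- In `f - b` the leading terms cancel and no monomial foreign to `f` appears, so its leading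
  -- monomial is a smaller monomial of `f`. Being in the ideal, it would have to be divisible by the
  -- leading monomial of `f`.
  have h0 : f - b ≠ 0 := sub_ne_zero.2 hne
  have hcoeff : (f - b).coeff (m.degree f) = 0 := by
    rw [hb, MvPolynomial.coeff_sub, (hG.monic f hf).coeff_degree]
    simp [MvPolynomial.coeff_monomial, hwf]
  have hdeg : m.degree (f - b) ≠ m.degree f := by
    intro h
    rw [← h] at hcoeff
    exact m.coeff_degree_ne_zero_iff.2 h0 hcoeff
  have hsupp : m.degree (f - b) ∈ f.support := by
    have := MvPolynomial.support_sub _ _ _ (m.degree_mem_support h0)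
    rw [Finset.mem_union] at this
    rcases this with h | h
    · exact h
    · have := MvPolynomial.support_sub _ _ _ h
      simp only [MvPolynomial.support_monomial, one_ne_zero, if_false, Finset.mem_union,
        Finset.mem_singleton] at this
      rcases this with h | h
      · exact absurd h hdeg
      · rwa [h]
  have hle := hG.degree_le_of_le_mem_support hf (I.sub_mem (hG.subset hf) hI) h0 hsupp le_rfl
  exact hdeg (m.toSyn.injective (le_antisymm (m.le_degree hsupp) (m.toSyn_monotone hle)))

end MonomialOrder

/-! ### Binomials in the toric ideal -/

namespace Hypergraph

variable {α : Type*} {H : Hypergraph α} {k : Type*} [Field k]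

/-- The exponent of the image of the monomial `t ^ u` under `t_e ↦ x ^ e`. -/
noncomputable def vertexExponent (H : Hypergraph α) [Finite H.vertexSet] (u : H.edgeSet →₀ ℕ) :
    H.vertexSet →₀ ℕ :=
  Finsupp.equivFunOnFinite.symm fun v => H.vertexDegree (Finsupp.toMultiset u) v

lemma vertexExponent_add [Finite H.vertexSet] (u w : H.edgeSet →₀ ℕ) :
    H.vertexExponent (u + w) = H.vertexExponent u + H.vertexExponent w := by
  ext v
  simp [vertexExponent]

lemma edgeMonomial_eq [Finite H.vertexSet] (e : H.edgeSet) :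
    H.edgeMonomial k e = MvPolynomial.monomial (H.vertexExponent (Finsupp.single e 1)) 1 := by
  classical
  cases nonempty_fintype H.vertexSet
  rw [edgeMonomial, finprod_mem_eq_finite_toFinset_prod _ (Set.toFinite _)]
  simp only [MvPolynomial.X]
  rw [← MvPolynomial.monomial_sum_one]
  refine congrArg (fun a => MvPolynomial.monomial a (1 : k)) (Finsupp.ext fun v => ?_)
  have := H.vertexDegree_cons e 0 v
  rw [vertexDegree_zero, zero_add, Multiset.cons_zero] at this
  simp [vertexExponent, Finsupp.finsetSum_apply, Finsupp.single_apply, this]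

lemma aeval_edgeMonomial_monomial [Finite H.vertexSet] (u : H.edgeSet →₀ ℕ) (c : k) :
    MvPolynomial.aeval (H.edgeMonomial k) (MvPolynomial.monomial u c) =
      MvPolynomial.monomial (H.vertexExponent u) c := by
  have h1 : MvPolynomial.aeval (H.edgeMonomial k) (MvPolynomial.monomial u (1 : k)) =
      MvPolynomial.monomial (H.vertexExponent u) 1 := by
    induction u using Finsupp.induction_linear with
    | zero =>
      have : H.vertexExponent 0 = 0 := by ext; simp [vertexExponent]
      rw [this]
      simp
    | add a b ha hb =>
      rw [vertexExponent_add, ← one_mul (1 : k), ← MvPolynomial.monomial_mul, map_mul, ha, hb,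
        MvPolynomial.monomial_mul]
    | single e n =>
      induction n with
      | zero =>
        have : H.vertexExponent 0 = 0 := by ext; simp [vertexExponent]
        rw [Finsupp.single_zero, this]
        simp
      | succ n ih =>
        rw [Finsupp.single_add, vertexExponent_add, ← one_mul (1 : k),
          ← MvPolynomial.monomial_mul, map_mul, ih, ← MvPolynomial.monomial_mul]
        congr 1
        rw [← edgeMonomial_eq]
        exact MvPolynomial.aeval_X _ _
  rw [← mul_one c, ← MvPolynomial.C_mul_monomial, map_mul, h1, MvPolynomial.aeval_C,
    MvPolynomial.algebraMap_eq, MvPolynomial.C_mul_monomial]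

lemma mem_toricIdeal_iff (f : MvPolynomial H.edgeSet k) :
    f ∈ H.toricIdeal k ↔ MvPolynomial.aeval (H.edgeMonomial k) f = 0 := by
  have : (H.edgeSubring k).val.comp (H.edgeHom k) = MvPolynomial.aeval (H.edgeMonomial k) := by
    ext e
    simp [edgeHom]
  rw [← this, toricIdeal, RingHom.mem_ker, AlgHom.comp_apply, Subalgebra.coe_val,
    ZeroMemClass.coe_eq_zero]

lemma monomial_sub_monomial_mem_toricIdeal (hV : H.vertexSet.Finite) {u w : H.edgeSet →₀ ℕ}
    (h : ∀ v, H.vertexDegree (Finsupp.toMultiset u) v = H.vertexDegree (Finsupp.toMultiset w) v) :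
    MvPolynomial.monomial u (1 : k) - MvPolynomial.monomial w 1 ∈ H.toricIdeal k := by
  have := hV.to_subtype
  rw [mem_toricIdeal_iff, map_sub, aeval_edgeMonomial_monomial, aeval_edgeMonomial_monomial,
    sub_eq_zero]
  congr 2
  ext v
  exact h v

lemma exists_mem_support_vertexDegree_eq (hV : H.vertexSet.Finite)
    {f : MvPolynomial H.edgeSet k} (hf : f ∈ H.toricIdeal k) {u : H.edgeSet →₀ ℕ}
    (hu : u ∈ f.support) : ∃ w ∈ f.support, w ≠ u ∧
      ∀ v, H.vertexDegree (Finsupp.toMultiset u) v = H.vertexDegree (Finsupp.toMultiset w) v := by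
  classical
  have := hV.to_subtype
  obtain ⟨w, hw, hwu, h⟩ : ∃ w ∈ f.support, w ≠ u ∧ H.vertexExponent w = H.vertexExponent u := by
    -- Otherwise `u` alone contributes to the coefficient of its image, which is then nonzero.
    by_contra! hc
    rw [mem_toricIdeal_iff, f.as_sum, map_sum] at hf
    simp only [aeval_edgeMonomial_monomial] at hf
    have h0 := congrArg (MvPolynomial.coeff (H.vertexExponent u)) hf
    rw [MvPolynomial.coeff_sum, Finset.sum_eq_single_of_mem u hu, MvPolynomial.coeff_monomial,
      if_pos rfl, MvPolynomial.coeff_zero] at h0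
    · exact MvPolynomial.mem_support_iff.1 hu h0
    · intro w hw hwu
      rw [MvPolynomial.coeff_monomial, if_neg (hc w hw hwu)]
  refine ⟨w, hw, hwu, fun v => ?_⟩
  by_cases hv : v ∈ H.vertexSet
  · exact (DFunLike.congr_fun h ⟨v, hv⟩).symm
  · rw [vertexDegree_eq_zero H hv, vertexDegree_eq_zero H hv]

lemma monomial_eq_prod_toMultiset (u : H.edgeSet →₀ ℕ) :
    MvPolynomial.monomial u (1 : k) = ((Finsupp.toMultiset u).map MvPolynomial.X).prod := by
  rw [MvPolynomial.monomial_eq, Finsupp.toMultiset_map, Finsupp.prod_toMultiset,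
    Finsupp.prod_mapDomain_index (fun _ => pow_zero _) (fun _ _ _ => pow_add _ _ _), map_one,
    one_mul]

lemma walkBinomial_eq {n : ℕ} (W : Fin (2 * n) → H.edgeSet) :
    H.walkBinomial k W = ((H.oddEdges W).map MvPolynomial.X).prod -
      ((H.evenEdges W).map MvPolynomial.X).prod := by
  simp only [walkBinomial, oddEdges, evenEdges, Multiset.map_map]
  rfl

/-- The exponents of a binomial in a reduced Gröbner basis of the toric ideal form a primitive
pair. -/
lemma isPrimitivePair_of_mem_reducedGroebnerBasis (hV : H.vertexSet.Finite) {d : ℕ} (hd : 1 ≤ d)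
    (hH : H.IsUniform d) {m : MonomialOrder H.edgeSet} {G : Set (MvPolynomial H.edgeSet k)}
    (hG : m.IsReducedGroebnerBasis (H.toricIdeal k) G) {f : MvPolynomial H.edgeSet k}
    (hf : f ∈ G) {w : H.edgeSet →₀ ℕ} (hw : w ∈ f.support) (hwf : w ≠ m.degree f)
    (hbal : ∀ v, H.vertexDegree (Finsupp.toMultiset (m.degree f)) v =
      H.vertexDegree (Finsupp.toMultiset w) v) :
    H.IsPrimitivePair (Finsupp.toMultiset (m.degree f)) (Finsupp.toMultiset w) := by
  classical
  have hinj : Function.Injective (Finsupp.toMultiset : (H.edgeSet →₀ ℕ) → _) :=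
    Multiset.toFinsupp.symm.injective
  have hcard := hH.card_eq_of_vertexDegree_eq hV hd hbal
  have hu : m.degree f ∈ f.support := m.degree_mem_support (hG.monic f hf).ne_zero
  -- The binomial `t ^ r - t ^ s` lies in the ideal. If it leads with `r`, then `m.degree f ≤ r`,
  -- which gives equality. If it leads with `s`, then `m.degree f ≤ s ≤ w`, and equal cardinality
  -- would force `w = m.degree f`.
  have key : ∀ R ≤ Finsupp.toMultiset (m.degree f), ∀ S ≤ Finsupp.toMultiset w,
      (∀ v, H.vertexDegree R v = H.vertexDegree S v) → R ≠ S →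
      R = Finsupp.toMultiset (m.degree f) := by
    intro R hR S hS hRS hne
    obtain ⟨r, rfl⟩ := Multiset.toFinsupp.symm.surjective R
    obtain ⟨s, rfl⟩ := Multiset.toFinsupp.symm.surjective S
    change Finsupp.toMultiset r ≤ _ at hR
    change Finsupp.toMultiset s ≤ _ at hS
    have hne' : r ≠ s := fun h => hne (by rw [h])
    have hr := Finsupp.orderIsoMultiset.le_iff_le.1 hR
    have hs := Finsupp.orderIsoMultiset.le_iff_le.1 hS
    have hI := monomial_sub_monomial_mem_toricIdeal (k := k) hV hRS
    have h0 : MvPolynomial.monomial r (1 : k) - MvPolynomial.monomial s 1 ≠ 0 := by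
      rw [sub_ne_zero, Ne, MvPolynomial.monomial_eq_monomial_iff]
      simp [hne']
    rcases m.degree_monomial_sub_monomial (k := k) hne' with h | h
    · have := hG.degree_le_of_le_mem_support hf hI h0 hu (h.trans_le hr)
      rw [h] at this
      exact congrArg Finsupp.toMultiset (le_antisymm hr this)
    · have := hG.degree_le_of_le_mem_support hf hI h0 hw (h.trans_le hs)
      rw [h] at this
      have hle := Finsupp.toMultiset_strictMono.monotone (this.trans hs)
      exact absurd (hinj
        (Multiset.eq_of_le_of_card_le hle hcard.ge)).symm hwf
  refine ⟨?_, hbal, ?_⟩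
  · intro h
    rw [h, Multiset.card_zero, eq_comm, Multiset.card_eq_zero] at hcard
    exact hwf (hinj (hcard.trans h.symm))
  · intro P hP Q hQ hPQ
    -- A common part `P = Q` is not seen by `key`, but its complements are balanced and distinct;
    -- `key` makes the complement in `U` all of `U`, so `P = 0`.
    by_cases hne : P = Q
    · subst hne
      obtain ⟨R, hR⟩ := Multiset.le_iff_exists_add.1 hP
      obtain ⟨S, hS⟩ := Multiset.le_iff_exists_add.1 hQ
      have := key R (hR ▸ Multiset.le_add_left R P) S (hS ▸ Multiset.le_add_left S P)
        (fun v => by simpa [hR, hS] using hbal v) (by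
          rintro rfl
          exact hwf (hinj (hS.trans hR.symm)))
      left
      rw [this] at hR
      exact right_eq_add.1 hR
    · have h1 := key P hP Q hQ hPQ hne
      refine Or.inr ⟨h1, Multiset.eq_of_le_of_card_le hQ ?_⟩
      rw [← hcard, ← h1, hH.card_eq_of_vertexDegree_eq hV hd hPQ]

end Hypergraph

theorem corollary2p7 {α : Type*} (H : Hypergraph α) (hV : H.vertexSet.Finite)
    (d : ℕ) (hd : 1 ≤ d) (hH : H.IsUniform d) (k : Type*) [Field k]
    (m : MonomialOrder H.edgeSet) (G : Set (MvPolynomial H.edgeSet k))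
    (hG : m.IsReducedGroebnerBasis (H.toricIdeal k) G)
    (f : MvPolynomial H.edgeSet k) (hf : f ∈ G) :
    ∃ (n : ℕ) (W : Fin (2 * n) → H.edgeSet),
      H.IsPrimitiveMonomialWalk W ∧ f = H.walkBinomial k W := by
  obtain ⟨w, hw, hwf, hbal⟩ := Hypergraph.exists_mem_support_vertexDegree_eq hV (hG.subset hf)
    (m.degree_mem_support (hG.monic f hf).ne_zero)
  obtain ⟨n, W, hW, hodd, heven⟩ := (Hypergraph.isPrimitivePair_of_mem_reducedGroebnerBasis hV hd
    hH hG hf hw hwf hbal).exists_isPrimitiveMonomialWalk hH hV hd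
  refine ⟨n, W, hW, ?_⟩
  rw [Hypergraph.walkBinomial_eq, hodd, heven, ← Hypergraph.monomial_eq_prod_toMultiset,
    ← Hypergraph.monomial_eq_prod_toMultiset]
  exact hG.eq_binomial hf hw hwf (Hypergraph.monomial_sub_monomial_mem_toricIdeal hV hbal)
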